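/- For $\gamma>0$ let the Paley–Wiener space $PW_\gamma$ consist of all $f\in L^2(\mathbb R)$ whose Fourier transform $\hat f(\omega)=\int_{\mathbb R} f(x)e^{-i\omega x}\,dx$ (extended to $L^2$ by Plancherel) vanishes for a.e. $\omega\in\mathbb R\setminus[-\gamma,\gamma]$. Every $f\in PW_\gamma$ is identified with its extension to an entire function, $f(z)=\frac1{2\pi}\int_{-\gamma}^{\gamma}\hat f(\omega)e^{i\omega z}\,d\omega$, and $f^\sharp(z)=\overline{f(\bar z)}$. For $f,g\in PW_\gamma$ write $f\sim g$ if there is $\lambda\in\mathbb C$ with $|\lambda|=1$ such that $f=\lambda g$ or $f=\lambda g^\sharp$; this is an equivalence relation. A sequence $(t_n)_{n\in\mathbb Z}$ of real numbers is a set of sampling for $PW_\gamma$ if there are constants $A,B>0$ with $A\|f\|^2\le\sum_n|f(t_n)|^2\le B\|f\|^2$ for all $f\in PW_\gamma$. **Theorem.** Let $\gamma>0$ and let $(t_n)_{n\in\mathbb Z}\subset\mathbb R$ be a set of sampling for $PW_{2\gamma}$. 1. For every $b$ with $0<b<\pi/\gamma$, the mapping $$\mathcal A: PW_\gamma/\!\sim\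 \to\ \ell^2(\mathbb Z)\oplus\ell^2(\mathbb Z),\qquad \mathcal A([f])=\bigl(|f(t_n)|,\ |f(t_n+b)-f(t_n)|\bigr)_{n\in\mathbb Z}$$ is well defined and injective. 2. The mapping $$\widetilde{\mathcal A}: PW_\gamma/\!\sim\ \to\ \ell^2(\mathbb Z)\oplus\ell^2(\mathbb Z),\qquad \widetilde{\mathcal A}([f])=\bigl(|f(t_n)|,\ |f'(t_n)|\bigr)_{n\in\mathbb Z}$$ is well defined and injective. (In particular this holds for $\gamma=\pi$.) -/

import Mathlib

open MeasureTheory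
open scoped FourierTransform ComplexConjugate ContDiff

noncomputable section

/-- The Paley-Wiener space `PW_γ`: all `f ∈ L²(ℝ)` whose Fourier transform
`f̂(ω) = ∫ f(x) e^{-iωx} dx` vanishes for a.e. `ω` outside `[-γ, γ]`. Mathlib's (Plancherel) Fourier
transform `𝓕` on `L²(ℝ)` uses the kernel `e^{-2πiξx}`, so that `f̂(ω) = 𝓕 f (ω / 2π)`, and the
condition reads: `𝓕 f ξ = 0` for a.e. `ξ` outside `[-γ/2π, γ/2π]`. -/
def PW (γ : ℝ) : Submodule ℂ (Lp ℂ 2 (volume : Measure ℝ)) where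
  carrier := {f | ∀ᵐ ξ : ℝ, ξ ∉ Set.Icc (-(γ / (2 * Real.pi))) (γ / (2 * Real.pi)) →
    (𝓕 f : Lp ℂ 2 (volume : Measure ℝ)) ξ = 0}
  add_mem' := by
    intro f g hf hg
    simp only [Set.mem_ofPred_eq] at hf hg ⊢
    rw [FourierTransform.fourier_add]
    filter_upwards [hf, hg, Lp.coeFn_add (𝓕 f : Lp ℂ 2 (volume : Measure ℝ)) (𝓕 g)]
      with ξ h1 h2 h3 hξ
    rw [h3, Pi.add_apply, h1 hξ, h2 hξ, add_zero]
  zero_mem' := by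
    simp only [Set.mem_ofPred_eq]
    rw [FourierTransform.fourier_zero]
    filter_upwards [Lp.coeFn_zero ℂ 2 (volume : Measure ℝ)] with ξ h _
    rw [h, Pi.zero_apply]
  smul_mem' := by
    intro c f hf
    simp only [Set.mem_ofPred_eq] at hf ⊢
    rw [FourierTransform.fourier_smul]
    filter_upwards [hf, Lp.coeFn_smul c (𝓕 f : Lp ℂ 2 (volume : Measure ℝ))] with ξ h1 h2 hξ
    rw [h2, Pi.smul_apply, h1 hξ, smul_zero]

/-- The extension of `f ∈ PW_γ` to an entire function,
`f(z) = ∫_{-γ/2π}^{γ/2π} 𝓕 f(ξ) e^{2πiξz} dξ = (1/2π) ∫_{-γ}^{γ} f̂(ω) e^{iωz} dω`.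
It is entire (`differentiable_pwExt`), and its restriction to the real line is a representative
of the `L²` class `f` (`pwExt_ae_eq`), hence the continuous one. The values `f(t)` and the
derivative `f'(t)` always refer to this function. -/
def pwExt {γ : ℝ} (f : PW γ) (z : ℂ) : ℂ :=
  ∫ ξ : ℝ in Set.Icc (-(γ / (2 * Real.pi))) (γ / (2 * Real.pi)),
    Complex.exp (2 * Real.pi * Complex.I * ξ * z) *
      (𝓕 (f : Lp ℂ 2 (volume : Measure ℝ)) : Lp ℂ 2 (volume : Measure ℝ)) ξ

theorem differentiable_pwExt {γ : ℝ} (f : PW γ) : Differentiable ℂ (pwExt f) := by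
  intro z₀
  set φ : Lp ℂ 2 (volume : Measure ℝ) := 𝓕 (f : Lp ℂ 2 (volume : Measure ℝ)) with hφ
  set s : Set ℝ := Set.Icc (-(γ / (2 * Real.pi))) (γ / (2 * Real.pi)) with hs
  set R : ℝ := |γ / (2 * Real.pi)| with hR
  have hint : Integrable (φ : ℝ → ℂ) (volume.restrict s) := by
    have : IsFiniteMeasure (volume.restrict s) := ⟨by
      rw [Measure.restrict_apply_univ]; exact isCompact_Icc.measure_lt_top⟩
    exact ((Lp.memLp φ).restrict s).integrable (by norm_num)
  have hmeas : ∀ z : ℂ, AEStronglyMeasurable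
      (fun ξ : ℝ => Complex.exp (2 * Real.pi * Complex.I * ξ * z) * φ ξ)
      (volume.restrict s) := fun z =>
    (Continuous.aestronglyMeasurable (by fun_prop)).mul hint.aestronglyMeasurable
  have hmem : ∀ ξ ∈ s, |ξ| ≤ R := fun ξ hξ => by
    rw [abs_le]
    exact ⟨by linarith [hξ.1, le_abs_self (γ / (2 * Real.pi))],
      hξ.2.trans (le_abs_self _)⟩
  have hR0 : 0 ≤ R := abs_nonneg _
  have hexp : ∀ ξ ∈ s, ∀ z : ℂ,
      ‖Complex.exp (2 * Real.pi * Complex.I * ξ * z)‖ ≤ Real.exp (2 * Real.pi * R * ‖z‖) := by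
    intro ξ hξ z
    refine (Complex.norm_exp_le_exp_norm _).trans (Real.exp_le_exp.2 ?_)
    have : ‖(2 * Real.pi * Complex.I * ξ * z : ℂ)‖ = 2 * Real.pi * |ξ| * ‖z‖ := by
      simp [abs_of_pos Real.pi_pos]
    rw [this]
    have := hmem ξ hξ
    have := Real.pi_pos
    gcongr
  have key := hasDerivAt_integral_of_dominated_loc_of_deriv_le
    (μ := volume.restrict s) (𝕜 := ℂ) (x₀ := z₀) (s := Metric.ball z₀ 1)
    (F := fun z (ξ : ℝ) => Complex.exp (2 * Real.pi * Complex.I * ξ * z) * φ ξ)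
    (F' := fun z (ξ : ℝ) => (Complex.exp (2 * Real.pi * Complex.I * ξ * z) *
      (2 * Real.pi * Complex.I * ξ)) * φ ξ)
    (bound := fun ξ => (Real.exp (2 * Real.pi * R * (‖z₀‖ + 1)) * (2 * Real.pi * R)) * ‖φ ξ‖)
    (Metric.ball_mem_nhds z₀ one_pos) (Filter.Eventually.of_forall hmeas)
    (hint.bdd_mul (c := Real.exp (2 * Real.pi * R * ‖z₀‖))
      (Continuous.aestronglyMeasurable (by fun_prop))
      ((ae_restrict_mem measurableSet_Icc).mono fun ξ hξ => hexp ξ hξ z₀))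
    ((Continuous.aestronglyMeasurable (by fun_prop)).mul hint.aestronglyMeasurable)
    ((ae_restrict_mem measurableSet_Icc).mono fun ξ hξ z hz => by
      rw [norm_mul, norm_mul]
      have h1 := hexp ξ hξ z
      have h2 : ‖z‖ ≤ ‖z₀‖ + 1 := by
        have := norm_le_norm_add_norm_sub' z z₀
        have h3 := mem_ball_iff_norm.1 hz
        linarith
      have h4 : ‖(2 * Real.pi * Complex.I * ξ : ℂ)‖ = 2 * Real.pi * |ξ| := by
        simp [abs_of_pos Real.pi_pos]
      rw [h4]
      have := hmem ξ hξ
      have := Real.pi_pos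
      refine mul_le_mul_of_nonneg_right ?_ (norm_nonneg _)
      refine mul_le_mul (h1.trans ?_) ?_ (by positivity) (by positivity)
      · gcongr
      · gcongr)
    (hint.norm.const_mul _)
    (Filter.Eventually.of_forall fun ξ z _ => by
      have h : HasDerivAt (fun z : ℂ => 2 * Real.pi * Complex.I * ξ * z)
          (2 * Real.pi * Complex.I * ξ) z := by
        simpa using (hasDerivAt_id z).const_mul (2 * Real.pi * Complex.I * ξ : ℂ)
      exact h.cexp.mul_const _)
  exact key.2.differentiableAt

theorem pwExt_ae_eq {γ : ℝ} (f : PW γ) :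
    (fun x : ℝ => pwExt f x) =ᵐ[volume] (f : Lp ℂ 2 (volume : Measure ℝ)) := by
  set φ : Lp ℂ 2 (volume : Measure ℝ) := 𝓕 (f : Lp ℂ 2 (volume : Measure ℝ)) with hφ
  set s : Set ℝ := Set.Icc (-(γ / (2 * Real.pi))) (γ / (2 * Real.pi)) with hs
  have hcont : Continuous (fun x : ℝ => pwExt f x) :=
    (differentiable_pwExt f).continuous.comp Complex.continuous_ofReal
  have hint : Integrable (φ : ℝ → ℂ) volume := by
    have : IsFiniteMeasure (volume.restrict s) := ⟨by
      rw [Measure.restrict_apply_univ]; exact isCompact_Icc.measure_lt_top⟩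
    have h : IntegrableOn (φ : ℝ → ℂ) s volume :=
      ((Lp.memLp φ).restrict s).integrable (by norm_num)
    exact h.integrable_of_ae_notMem_eq_zero f.2
  have hext : ∀ x : ℝ, pwExt f x = 𝓕⁻ (φ : ℝ → ℂ) x := by
    intro x
    rw [Real.fourierInv_eq']
    have : pwExt f x = ∫ ξ in s, Complex.exp (2 * Real.pi * Complex.I * ξ * x) * φ ξ := rfl
    rw [this, setIntegral_eq_integral_of_ae_compl_eq_zero]
    · refine integral_congr_ae (Filter.Eventually.of_forall fun ξ => ?_)
      simp only [smul_eq_mul]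
      congr 2
      simp
      ring
    · filter_upwards [f.2] with ξ hξ h
      have h' : φ ξ = 0 := hξ h
      rw [h', mul_zero]
  have hf : (f : Lp ℂ 2 (volume : Measure ℝ)) = 𝓕⁻ φ :=
    (FourierTransform.fourierInv_fourier_eq _).symm
  refine ae_eq_of_integral_contDiff_smul_eq hcont.locallyIntegrable
    ((Lp.memLp (f : Lp ℂ 2 (volume : Measure ℝ))).locallyIntegrable (by norm_num)) ?_
  intro g hg hgs
  have hg' : ContDiff ℝ ∞ (fun x => (g x : ℂ)) := Complex.ofRealCLM.contDiff.comp hg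
  have hgs' : HasCompactSupport (fun x => (g x : ℂ)) :=
    hgs.comp_left (g := fun y : ℝ => (y : ℂ)) Complex.ofReal_zero
  let G : SchwartzMap ℝ ℂ := hgs'.toSchwartzMap hg'
  have h1 : ∫ x, g x • (f : Lp ℂ 2 (volume : Measure ℝ)) x =
      Lp.toTemperedDistribution (f : Lp ℂ 2 (volume : Measure ℝ)) G := by
    rw [Lp.toTemperedDistribution_apply]
    refine integral_congr_ae (Filter.Eventually.of_forall fun x => ?_)
    simp [G]
  have h2 : Lp.toTemperedDistribution (f : Lp ℂ 2 (volume : Measure ℝ)) G =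
      ∫ x, (𝓕⁻ G : SchwartzMap ℝ ℂ) x • φ x := by
    rw [hf, ← Lp.fourierInv_toTemperedDistribution_eq, TemperedDistribution.fourierInv_apply,
      Lp.toTemperedDistribution_apply]
  have h3 := VectorFourier.integral_fourierIntegral_smul_eq_flip (L := -innerₗ ℝ)
    (μ := volume) (ν := volume) (f := (G : ℝ → ℂ)) (g := (φ : ℝ → ℂ))
    Real.continuous_fourierChar (continuous_inner (𝕜 := ℝ) (E := ℝ)).neg G.integrable hint
  have h4 : ∀ ψ : ℝ → ℂ, VectorFourier.fourierIntegral Real.fourierChar volume (-innerₗ ℝ) ψ =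
      𝓕⁻ ψ := fun ψ => by
    ext w
    simp [VectorFourier.fourierIntegral, Real.fourierInv_eq]
  have h5 : (-innerₗ ℝ).flip = -innerₗ ℝ := by
    ext; simp
  rw [h5, h4, h4] at h3
  rw [h1, h2, SchwartzMap.fourierInv_coe, h3]
  refine integral_congr_ae (Filter.Eventually.of_forall fun x => ?_)
  simp [G, hext]

/-- `{t_n}` is a set of sampling for `PW_γ`:
`A ‖f‖² ≤ ∑ |f(t_n)|² ≤ B ‖f‖²` for all `f ∈ PW_γ`, with constants `A, B > 0`. -/
def IsSetOfSampling (γ : ℝ) (t : ℤ → ℝ) : Prop :=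
  ∃ A B : ℝ, 0 < A ∧ 0 < B ∧ ∀ f : PW γ,
    Summable (fun n => ‖pwExt f (t n)‖ ^ 2) ∧
    A * ‖f‖ ^ 2 ≤ ∑' n, ‖pwExt f (t n)‖ ^ 2 ∧
    ∑' n, ‖pwExt f (t n)‖ ^ 2 ≤ B * ‖f‖ ^ 2

/-- The entire function `F^♯(z) = conj (F (conj z))`. -/
def sharp (F : ℂ → ℂ) (z : ℂ) : ℂ := conj (F (conj z))

/-- The equivalence relation on `PW_γ`: `f ∼ g` if `f = λ g` or `f = λ g^♯` for some `|λ| = 1`,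
as entire functions. -/
def pwSetoid (γ : ℝ) : Setoid (PW γ) where
  r f g := ∃ c : ℂ, ‖c‖ = 1 ∧ (pwExt f = c • pwExt g ∨ pwExt f = c • sharp (pwExt g))
  iseqv := by
    have inv : ∀ c : ℂ, ‖c‖ = 1 → conj c * c = 1 := fun c hc => by
      rw [Complex.conj_mul', hc]; norm_num
    refine ⟨fun f => ⟨1, by simp, Or.inl (by simp)⟩, ?_, ?_⟩
    · rintro f g ⟨c, hc, h | h⟩
      · refine ⟨conj c, by simpa using hc, Or.inl ?_⟩
        rw [h, smul_smul, inv c hc, one_smul]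
      · refine ⟨c, hc, Or.inr ?_⟩
        ext z
        have := inv c hc
        simp only [h, sharp, Pi.smul_apply, smul_eq_mul, map_mul, Complex.conj_conj]
        linear_combination -(pwExt g z) * this
    · rintro f g k ⟨c, hc, h | h⟩ ⟨d, hd, h' | h'⟩
      · exact ⟨c * d, by simp [hc, hd], Or.inl (by rw [h, h', smul_smul])⟩
      · exact ⟨c * d, by simp [hc, hd], Or.inr (by rw [h, h', smul_smul])⟩
      · refine ⟨c * conj d, by simp [hc, hd], Or.inr ?_⟩
        ext z
        simp only [h, h', sharp, Pi.smul_apply, smul_eq_mul, map_mul]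
        ring
      · refine ⟨c * conj d, by simp [hc, hd], Or.inl ?_⟩
        ext z
        simp only [h, h', sharp, Pi.smul_apply, smul_eq_mul, map_mul, Complex.conj_conj]
        ring

/-- The real sequence space `ℓ²(ℤ)`. -/
abbrev EllTwo : Type := lp (fun _ : ℤ => ℝ) 2

end

/-! On the real line `|f|² = f f^♯`, and `f f^♯` has twice the band of `f`. Sampling for `PW (2 *
γ)` therefore turns equal measurements into identities of entire functions: `f f^♯ = g g^♯` and `Df
(Df)^♯ = Dg (Dg)^♯`, where `D` is the difference or the derivative (`IsSetOfSampling.mul_sharp_eq`).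
For the difference put `P = f(z + b) f^♯(z)` and `P' = f(z) f^♯(z + b)`; for the derivative, `P = f'
f^♯` and `P' = f (f')^♯`. The two identities fix `P + P'` and `P P'`, hence the unordered pair `{P,
P'}`, since entire functions form an integral domain. Swapping `P` and `P'` amounts to replacing `g`
by `g^♯`, so `P` may be taken equal for `f` and `g`. Then `f / g` is `b`-periodic, respectively has
derivative zero. In the first case `g(w) f - f(w) g` vanishes on `w + bℤ`, which is dense enough to
force it to be zero because `b < π / γ`. Either way `f = c g`, and `f f^♯ = g g^♯` gives `|c| = 1`.
-/

/-- `F` is the Fourier-Laplace transform of a square integrable function vanishing outside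
`[-R, R]`. -/
def IsBandlimited (R : ℝ) (F : ℂ → ℂ) : Prop :=
  ∃ ψ : ℝ → ℂ, MemLp ψ 2 ∧ (∀ ξ, ξ ∉ Set.Icc (-R) R → ψ ξ = 0) ∧
    ∀ z, F z = ∫ ξ : ℝ, Complex.exp (2 * Real.pi * Complex.I * ξ * z) * ψ ξ

/-! ### Compactly supported L² spectra -/

section Spectrum

variable {R : ℝ} {ψ : ℝ → ℂ}

theorem MeasureTheory.MemLp.continuous_mul_of_support_Icc (hψ : MemLp ψ 2)
    (hs : ∀ ξ, ξ ∉ Set.Icc (-R) R → ψ ξ = 0) {c : ℝ → ℂ} (hc : Continuous c) :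
    MemLp (fun ξ => c ξ * ψ ξ) 2 := by
  obtain ⟨C, hC⟩ := (isCompact_Icc (a := -R) (b := R)).exists_bound_of_continuousOn hc.continuousOn
  refine hψ.of_le_mul (c := C) (hc.aestronglyMeasurable.mul hψ.1) (ae_of_all _ fun ξ => ?_)
  by_cases h : ξ ∈ Set.Icc (-R) R
  · rw [norm_mul]
    gcongr
    exact hC ξ h
  · simp [hs ξ h]

theorem MeasureTheory.MemLp.integrable_of_support_Icc (hψ : MemLp ψ 2)
    (hs : ∀ ξ, ξ ∉ Set.Icc (-R) R → ψ ξ = 0) : Integrable ψ := by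
  have h : IntegrableOn ψ (Set.Icc (-R) R) := by
    have : IsFiniteMeasure (volume.restrict (Set.Icc (-R) R)) := ⟨by
      rw [Measure.restrict_apply_univ]; exact isCompact_Icc.measure_lt_top⟩
    exact (hψ.restrict _).integrable (by norm_num)
  exact h.integrable_of_forall_notMem_eq_zero hs

theorem MeasureTheory.MemLp.integrable_continuous_mul_of_support_Icc (hψ : MemLp ψ 2)
    (hs : ∀ ξ, ξ ∉ Set.Icc (-R) R → ψ ξ = 0) {c : ℝ → ℂ} (hc : Continuous c) :
    Integrable (fun ξ => c ξ * ψ ξ) :=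
  (hψ.continuous_mul_of_support_Icc hs hc).integrable_of_support_Icc (R := R)
    fun ξ h => by simp [hs ξ h]

theorem hasDerivAt_integral_exp_mul (hψ : MemLp ψ 2)
    (hs : ∀ ξ, ξ ∉ Set.Icc (-R) R → ψ ξ = 0) (z₀ : ℂ) :
    HasDerivAt (fun z : ℂ => ∫ ξ : ℝ, Complex.exp (2 * Real.pi * Complex.I * ξ * z) * ψ ξ)
      (∫ ξ : ℝ, Complex.exp (2 * Real.pi * Complex.I * ξ * z₀) *
        (2 * Real.pi * Complex.I * ξ * ψ ξ)) z₀ := by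
  refine (hasDerivAt_integral_of_dominated_loc_of_deriv_le
    (F := fun z (ξ : ℝ) => Complex.exp (2 * Real.pi * Complex.I * ξ * z) * ψ ξ)
    (F' := fun z (ξ : ℝ) => Complex.exp (2 * Real.pi * Complex.I * ξ * z) *
      (2 * Real.pi * Complex.I * ξ * ψ ξ))
    -- The bound is the norm of a continuous multiple of `ψ`, so compact support makes it
    -- integrable.
    (bound := fun ξ => ‖((Real.exp (2 * Real.pi * |ξ| * (‖z₀‖ + 1)) * (2 * Real.pi * |ξ|) : ℝ) : ℂ)
      * ψ ξ‖)
    (Metric.ball_mem_nhds z₀ one_pos)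
    (Filter.Eventually.of_forall fun z =>
      (Continuous.aestronglyMeasurable (by fun_prop)).mul hψ.1)
    (hψ.integrable_continuous_mul_of_support_Icc hs (by fun_prop))
    ((Continuous.aestronglyMeasurable (by fun_prop)).mul
      ((Continuous.aestronglyMeasurable (by fun_prop)).mul hψ.1))
    (ae_of_all _ fun ξ z hz => ?_)
    (hψ.integrable_continuous_mul_of_support_Icc hs (by fun_prop)).norm
    (ae_of_all _ fun ξ z _ => ?_)).2
  · have h2 : ‖z‖ ≤ ‖z₀‖ + 1 := by
      have := norm_le_norm_add_norm_sub' z z₀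
      have h3 := mem_ball_iff_norm.1 hz
      linarith
    have h4 : ‖(2 * Real.pi * Complex.I * ξ : ℂ)‖ = 2 * Real.pi * |ξ| := by
      simp [abs_of_pos Real.pi_pos]
    have h1 : ‖Complex.exp (2 * Real.pi * Complex.I * ξ * z)‖ ≤
        Real.exp (2 * Real.pi * |ξ| * (‖z₀‖ + 1)) := by
      refine (Complex.norm_exp_le_exp_norm _).trans (Real.exp_le_exp.2 ?_)
      rw [norm_mul, h4]
      gcongr
    rw [← mul_assoc, norm_mul, norm_mul, h4, norm_mul, Complex.norm_real,
      Real.norm_of_nonneg (by positivity)]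
    gcongr
  · have h : HasDerivAt (fun z : ℂ => 2 * Real.pi * Complex.I * ξ * z)
        (2 * Real.pi * Complex.I * ξ) z := by
      simpa using (hasDerivAt_id z).const_mul (2 * Real.pi * Complex.I * ξ : ℂ)
    exact (h.cexp.mul_const _).congr_deriv (by ring)

/-- Pointwise `ab ≤ a² + b²`. This crude bound suffices: a bounded function with compact support is
in L². -/
theorem norm_convolution_mul_le {φ : ℝ → ℂ} (hφ : MemLp φ 2) (hψ : MemLp ψ 2) (x : ℝ) :
    ‖(convolution φ ψ (ContinuousLinearMap.mul ℂ ℂ) volume) x‖ ≤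
      (∫ t, ‖φ t‖ ^ 2) + ∫ t, ‖ψ t‖ ^ 2 := by
  have h1 : Integrable (fun t => ‖φ t‖ ^ 2) := hφ.integrable_norm_pow (by norm_num)
  have h2 : Integrable (fun t => ‖ψ t‖ ^ 2) := hψ.integrable_norm_pow (by norm_num)
  have h3 : ∫ t, ‖ψ t‖ ^ 2 = ∫ t, ‖ψ (x - t)‖ ^ 2 :=
    (integral_sub_left_eq_self (fun t => ‖ψ t‖ ^ 2) volume x).symm
  rw [h3, ← integral_add h1 (h2.comp_sub_left x)]
  refine norm_integral_le_of_norm_le (h1.add (h2.comp_sub_left x)) (ae_of_all _ fun t => ?_)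
  simp only [ContinuousLinearMap.mul_apply', norm_mul]
  nlinarith [sq_nonneg (‖φ t‖ - ‖ψ (x - t)‖), sq_nonneg (‖φ t‖), sq_nonneg (‖ψ (x - t)‖)]

end Spectrum

/-! ### Closure properties of bandlimited functions, and uniqueness on lattices -/

namespace IsBandlimited

variable {R : ℝ} {F G : ℂ → ℂ}

theorem differentiable (hF : IsBandlimited R F) : Differentiable ℂ F := by
  obtain ⟨ψ, hψ, hs, h⟩ := hF
  rw [funext h]
  exact fun z => (hasDerivAt_integral_exp_mul hψ hs z).differentiableAt

theorem deriv (hF : IsBandlimited R F) : IsBandlimited R (deriv F) := by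
  obtain ⟨ψ, hψ, hs, h⟩ := hF
  refine ⟨fun ξ => 2 * Real.pi * Complex.I * ξ * ψ ξ,
    hψ.continuous_mul_of_support_Icc hs (by fun_prop), fun ξ hξ => by simp [hs ξ hξ], fun z => ?_⟩
  rw [funext h]
  exact (hasDerivAt_integral_exp_mul hψ hs z).deriv

theorem sub (hF : IsBandlimited R F) (hG : IsBandlimited R G) : IsBandlimited R (F - G) := by
  obtain ⟨φ, hφ, hs, h⟩ := hF
  obtain ⟨ψ, hψ, hs', h'⟩ := hG
  refine ⟨φ - ψ, hφ.sub hψ, fun ξ hξ => by simp [hs ξ hξ, hs' ξ hξ], fun z => ?_⟩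
  rw [Pi.sub_apply, h, h', ← integral_sub
    (hφ.integrable_continuous_mul_of_support_Icc hs (by fun_prop))
    (hψ.integrable_continuous_mul_of_support_Icc hs' (by fun_prop))]
  simp [mul_sub]

theorem const_smul (hF : IsBandlimited R F) (c : ℂ) : IsBandlimited R (c • F) := by
  obtain ⟨φ, hφ, hs, h⟩ := hF
  refine ⟨c • φ, hφ.const_smul c, fun ξ hξ => by simp [hs ξ hξ], fun z => ?_⟩
  rw [Pi.smul_apply, h, smul_eq_mul, ← integral_const_mul]
  refine integral_congr_ae (ae_of_all _ fun ξ => ?_)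
  simp only [Pi.smul_apply, smul_eq_mul]
  ring

theorem comp_add_const (hF : IsBandlimited R F) (w : ℂ) :
    IsBandlimited R (fun z => F (z + w)) := by
  obtain ⟨φ, hφ, hs, h⟩ := hF
  refine ⟨fun ξ => Complex.exp (2 * Real.pi * Complex.I * ξ * w) * φ ξ,
    hφ.continuous_mul_of_support_Icc hs (by fun_prop), fun ξ hξ => by simp [hs ξ hξ], fun z => ?_⟩
  simp only [h, mul_add, Complex.exp_add, mul_assoc]

theorem sharp (hF : IsBandlimited R F) : IsBandlimited R (sharp F) := by
  obtain ⟨φ, hφ, hs, h⟩ := hF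
  refine ⟨fun ξ => conj (φ (-ξ)), ?_, fun ξ hξ => ?_, fun z => ?_⟩
  · exact (hφ.comp_measurePreserving (Measure.measurePreserving_neg volume)).star
  · have : φ (-ξ) = 0 := hs _ fun h => hξ ⟨by linarith [h.2], by linarith [h.1]⟩
    simp [this]
  · rw [_root_.sharp, h, ← integral_conj, ← integral_neg_eq_self]
    refine integral_congr_ae (ae_of_all _ fun ξ => ?_)
    simp only [map_mul, ← Complex.exp_conj, Complex.conj_conj, Complex.conj_ofReal,
      Complex.conj_I, map_ofNat]
    congr 2
    push_cast
    ring

theorem mono {R' : ℝ} (hF : IsBandlimited R F) (hR : R ≤ R') : IsBandlimited R' F := by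
  obtain ⟨φ, hφ, hs, h⟩ := hF
  exact ⟨φ, hφ, fun ξ hξ => hs ξ fun h => hξ ⟨by linarith [h.1], by linarith [h.2]⟩, h⟩

/-- The spectrum of a product is the convolution of the spectra. The weight `exp (2πiξz)` is
multiplicative in `ξ`, so it passes through the convolution even for complex `z`. -/
theorem mul (hF : IsBandlimited R F) (hG : IsBandlimited R G) :
    IsBandlimited (R + R) (F * G) := by
  obtain ⟨φ, hφ, hs, h⟩ := hF
  obtain ⟨ψ, hψ, hs', h'⟩ := hG
  have hφ1 := hφ.integrable_of_support_Icc hs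
  have hψ1 := hψ.integrable_of_support_Icc hs'
  set L := ContinuousLinearMap.mul ℂ ℂ
  have hsupp : ∀ ξ, ξ ∉ Set.Icc (-(R + R)) (R + R) → convolution φ ψ L volume ξ = 0 := by
    intro ξ hξ
    refine integral_eq_zero_of_ae (ae_of_all _ fun t => ?_)
    by_cases ht : t ∈ Set.Icc (-R) R
    · have : ψ (ξ - t) = 0 := hs' _ fun h => hξ
        ⟨by linarith [h.1, ht.1], by linarith [h.2, ht.2]⟩
      simp [L, this]
    · simp [L, hs t ht]
  refine ⟨convolution φ ψ L volume, ?_, hsupp, fun z => ?_⟩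
  · have hm := (hφ1.integrable_convolution L hψ1).1
    have : IsFiniteMeasure (volume.restrict (Set.Icc (-(R + R)) (R + R))) := ⟨by
      rw [Measure.restrict_apply_univ]; exact isCompact_Icc.measure_lt_top⟩
    have h2 : MemLp (convolution φ ψ L volume) 2
        (volume.restrict (Set.Icc (-(R + R)) (R + R))) :=
      MemLp.of_bound hm.restrict _ (ae_of_all _ (norm_convolution_mul_le hφ hψ))
    rw [← memLp_indicator_iff_restrict measurableSet_Icc] at h2
    rwa [Set.indicator_eq_self.2] at h2
    exact fun ξ hξ => by_contra fun h => hξ (hsupp ξ h)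
  · have key := integral_convolution (μ := volume) (ν := volume) L
      (hφ.integrable_continuous_mul_of_support_Icc hs
        (c := fun ξ => Complex.exp (2 * Real.pi * Complex.I * ξ * z)) (by fun_prop))
      (hψ.integrable_continuous_mul_of_support_Icc hs'
        (c := fun ξ => Complex.exp (2 * Real.pi * Complex.I * ξ * z)) (by fun_prop))
    rw [Pi.mul_apply, h, h']
    refine key.symm.trans (integral_congr_ae (ae_of_all _ fun ξ => ?_))
    simp only [convolution, L, ContinuousLinearMap.mul_apply']
    rw [← integral_const_mul]
    refine integral_congr_ae (ae_of_all _ fun t => ?_)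
    have : Complex.exp (2 * Real.pi * Complex.I * ξ * z) =
        Complex.exp (2 * Real.pi * Complex.I * t * z) *
          Complex.exp (2 * Real.pi * Complex.I * ((ξ - t : ℝ) : ℂ) * z) := by
      rw [← Complex.exp_add]
      congr 1
      push_cast
      ring
    simp only [this]
    ring

/-- A function with band `[-R, R]` is determined by its values on a lattice of spacing less than
`1 / (2R)`. -/
theorem eq_zero_of_forall_lattice_eq_zero {b : ℝ} (hF : IsBandlimited R F) (hb : 0 < b)
    (hR : 2 * R * b < 1) (x : ℂ) (h0 : ∀ k : ℤ, F (x + k * b) = 0) : F = 0 := by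
  obtain ⟨φ, hφ, hs, h⟩ := hF
  -- The support of `χ` fits in one interval of length `1 / b`, where its Fourier coefficients are
  -- multiples of the values of `F` on `x + bℤ`.
  set χ : ℝ → ℂ := fun ξ => Complex.exp (2 * Real.pi * Complex.I * ξ * x) * φ ξ with hχ
  have hχ2 : MemLp χ 2 := hφ.continuous_mul_of_support_Icc hs (by fun_prop)
  have hlt : -(1 / (2 * b)) < 1 / (2 * b) := by
    have : 0 < 1 / (2 * b) := by positivity
    linarith
  have hRb : R < 1 / (2 * b) := by
    rw [lt_div_iff₀ (by positivity)]
    linarith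
  have hsub : ∀ ξ, ξ ∉ Set.Ioc (-(1 / (2 * b))) (1 / (2 * b)) → χ ξ = 0 := fun ξ hξ => by
    have : φ ξ = 0 := hs ξ fun h => hξ ⟨by linarith [h.1], by linarith [h.2]⟩
    simp [hχ, this]
  have hcoeff : ∀ n : ℤ, fourierCoeffOn hlt χ n = 0 := by
    intro n
    rw [fourierCoeffOn_eq_integral, intervalIntegral.integral_of_le hlt.le,
      setIntegral_eq_integral_of_forall_compl_eq_zero fun ξ hξ => by rw [hsub ξ hξ, smul_zero]]
    refine smul_eq_zero_of_right _ ?_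
    -- The `n`-th coefficient carries `exp (-2πinbξ)`, hence the lattice index `-n`.
    rw [← h0 (-n), h]
    refine integral_congr_ae (ae_of_all _ fun ξ => ?_)
    simp only [fourier_coe_apply, smul_eq_mul, hχ]
    rw [← mul_assoc, ← Complex.exp_add]
    congr 2
    have : (b : ℂ) ≠ 0 := by exact_mod_cast hb.ne'
    push_cast
    field_simp
    ring
  have hint : ∫ ξ in (-(1 / (2 * b)))..(1 / (2 * b)), ‖χ ξ‖ ^ 2 = 0 := by
    have hsum := hasSum_sq_fourierCoeffOn hlt (hχ2.restrict _)
    simp only [hcoeff, norm_zero, ne_eq, OfNat.ofNat_ne_zero, not_false_eq_true, zero_pow] at hsum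
    have := hsum.unique hasSum_zero
    rw [smul_eq_mul, mul_eq_zero, inv_eq_zero, sub_eq_zero] at this
    exact this.resolve_left hlt.ne'
  rw [intervalIntegral.integral_of_le hlt.le,
    setIntegral_eq_integral_of_forall_compl_eq_zero fun ξ hξ => by rw [hsub ξ hξ]; simp,
    integral_eq_zero_iff_of_nonneg (fun _ => by positivity)
      (hχ2.integrable_norm_pow (by norm_num))] at hint
  ext z
  rw [h, Pi.zero_apply]
  refine integral_eq_zero_of_ae ?_
  filter_upwards [hint] with ξ hξ
  -- For complex `x` the exponential factor is not unimodular, but it never vanishes.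
  have : φ ξ = 0 := by simpa [hχ] using hξ
  simp [this]

end IsBandlimited

/-! ### Bandlimited functions and `PW γ` -/

theorem isBandlimited_pwExt {γ : ℝ} (f : PW γ) : IsBandlimited (γ / (2 * Real.pi)) (pwExt f) := by
  set s := Set.Icc (-(γ / (2 * Real.pi))) (γ / (2 * Real.pi)) with hs
  set φ : Lp ℂ 2 (volume : Measure ℝ) := 𝓕 (f : Lp ℂ 2 (volume : Measure ℝ)) with hφ
  refine ⟨s.indicator φ, (Lp.memLp φ).indicator measurableSet_Icc,
    fun ξ hξ => Set.indicator_of_notMem hξ _, fun z => ?_⟩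
  rw [pwExt, ← integral_indicator measurableSet_Icc]
  simp only [Set.indicator_mul_right]
  rfl

/-- Needed to apply the sampling inequalities to functions built by hand, such as `F * sharp F`. -/
theorem IsBandlimited.exists_pwExt_eq {γ : ℝ} {F : ℂ → ℂ}
    (hF : IsBandlimited (γ / (2 * Real.pi)) F) : ∃ f : PW γ, pwExt f = F := by
  obtain ⟨ψ, hψ, hs, h⟩ := hF
  have hmem : (𝓕⁻ hψ.toLp : Lp ℂ 2 (volume : Measure ℝ)) ∈ PW γ := by
    change ∀ᵐ ξ : ℝ, _ → (𝓕 (𝓕⁻ hψ.toLp : Lp ℂ 2 (volume : Measure ℝ)) :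
      Lp ℂ 2 (volume : Measure ℝ)) ξ = 0
    rw [FourierTransform.fourier_fourierInv_eq]
    filter_upwards [hψ.coeFn_toLp] with ξ hξ h
    rw [hξ, hs ξ h]
  refine ⟨⟨_, hmem⟩, funext fun z => ?_⟩
  have hz : ∀ ξ, ξ ∉ Set.Icc (-(γ / (2 * Real.pi))) (γ / (2 * Real.pi)) →
      Complex.exp (2 * Real.pi * Complex.I * ξ * z) * ψ ξ = 0 := fun ξ hξ => by
    rw [hs ξ hξ, mul_zero]
  rw [h, pwExt, FourierTransform.fourier_fourierInv_eq,
    ← setIntegral_eq_integral_of_forall_compl_eq_zero hz]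
  refine integral_congr_ae (ae_restrict_of_ae ?_)
  filter_upwards [hψ.coeFn_toLp] with ξ hξ
  rw [hξ]

/-! ### Entire functions: cancellation and proportionality -/

section Entire

variable {F G K : ℂ → ℂ}

@[simp]
theorem sharp_sharp (F : ℂ → ℂ) : sharp (sharp F) = F := by
  ext z
  simp [sharp]

theorem sharp_smul (c : ℂ) (F : ℂ → ℂ) : sharp (c • F) = conj c • sharp F := by
  ext z
  simp [sharp]

theorem sharp_eq_zero_iff : sharp F = 0 ↔ F = 0 := by
  have h0 : sharp 0 = 0 := by ext z; simp [sharp]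
  refine ⟨fun h => ?_, fun h => by rw [h, h0]⟩
  rw [← sharp_sharp F, h, h0]

theorem deriv_sharp (F : ℂ → ℂ) : deriv (sharp F) = sharp (deriv F) :=
  deriv_conj_conj

theorem Differentiable.sharp (hF : Differentiable ℂ F) : Differentiable ℂ (sharp F) :=
  fun _ => differentiableAt_conj_conj_iff.2 (hF _)

theorem Differentiable.analyticOnNhd_univ (hF : Differentiable ℂ F) :
    AnalyticOnNhd ℂ F Set.univ :=
  fun z _ => hF.analyticAt z

theorem Differentiable.mul_eq_zero (hF : Differentiable ℂ F) (hG : Differentiable ℂ G)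
    (h : ∀ z, F z * G z = 0) : F = 0 ∨ G = 0 := by
  refine (hF.analyticOnNhd_univ.eq_zero_or_eq_zero_of_mul_eq_zero hG.analyticOnNhd_univ
    (fun z _ => h z) isPreconnected_univ).imp ?_ ?_ <;>
  exact fun h => funext fun z => h z (Set.mem_univ z)

theorem Differentiable.mul_left_cancel (hK : Differentiable ℂ K) (hK0 : K ≠ 0)
    (hF : Differentiable ℂ F) (hG : Differentiable ℂ G) (h : ∀ z, K z * F z = K z * G z) :
    F = G := by
  have := (hK.mul_eq_zero (hF.sub hG) fun z => by
    rw [Pi.sub_apply, mul_sub, h, sub_self]).resolve_left hK0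
  exact sub_eq_zero.1 this

/-- Pairs of entire functions with the same sum and product agree up to order. -/
theorem Differentiable.eq_or_eq_of_add_eq_of_mul_eq {P P' Q Q' : ℂ → ℂ}
    (hP : Differentiable ℂ P) (hQ : Differentiable ℂ Q) (hQ' : Differentiable ℂ Q')
    (hadd : ∀ z, P z + P' z = Q z + Q' z) (hmul : ∀ z, P z * P' z = Q z * Q' z) :
    P = Q ∨ P = Q' := by
  refine ((hP.sub hQ).mul_eq_zero (hP.sub hQ') fun z => ?_).imp sub_eq_zero.1 sub_eq_zero.1
  simp only [Pi.sub_apply]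
  linear_combination (P z) * hadd z - hmul z

/-- Once `F = c • K`, the product identity reads `(|c|² - 1) K K^♯ = 0` with `K ≠ 0`. -/
theorem exists_norm_one_eq_smul_of_mul_sharp_eq (hK : Differentiable ℂ K) (h : F * sharp F = K * sharp K)
    (hdep : ∃ w, K w ≠ 0 ∧ ∀ z, K w * F z = F w * K z) : ∃ c : ℂ, ‖c‖ = 1 ∧ F = c • K := by
  obtain ⟨w, hw, hz⟩ := hdep
  set c := F w / K w with hc
  have hFc : F = c • K := funext fun z => by
    rw [Pi.smul_apply, smul_eq_mul, hc, div_mul_eq_mul_div, eq_div_iff hw, ← hz z, mul_comm]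
  refine ⟨c, ?_, hFc⟩
  have hK0 : K ≠ 0 := fun h => hw (by rw [h, Pi.zero_apply])
  by_contra hne
  have h1 : c * conj c - 1 ≠ 0 := by
    rw [Complex.mul_conj', sub_ne_zero]
    norm_cast
    rwa [pow_eq_one_iff_of_nonneg (norm_nonneg c) two_ne_zero]
  have h0 := hK.mul_eq_zero hK.sharp fun z => by
    have h2 := congrFun h z
    rw [hFc, sharp_smul] at h2
    simp only [Pi.mul_apply, Pi.smul_apply, smul_eq_mul] at h2
    refine (mul_eq_zero.1 ?_).resolve_left h1
    linear_combination h2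
  exact h0.elim hK0 fun h0 => hK0 (sharp_eq_zero_iff.1 h0)

theorem exists_norm_one_eq_smul_of_eq_zero (hF : Differentiable ℂ F)
    (h : F * sharp F = K * sharp K) (hK : K = 0) : ∃ c : ℂ, ‖c‖ = 1 ∧ F = c • K := by
  refine ⟨1, norm_one, ?_⟩
  rw [hK, zero_mul] at h
  rw [one_smul, hK]
  rcases hF.mul_eq_zero hF.sharp (fun z => congrFun h z) with h0 | h0
  · exact h0
  · exact sharp_eq_zero_iff.1 h0

/-- If `T F · F^♯ = T K · K^♯` and `F F^♯ = K K^♯`, then `T F · K = F · T K`. -/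
theorem mul_eq_mul_of_mul_sharp_eq {F' K' : ℂ → ℂ} (hF : Differentiable ℂ F)
    (hK : Differentiable ℂ K) (hF' : Differentiable ℂ F') (hK' : Differentiable ℂ K')
    (h : F * sharp F = K * sharp K) (hK0 : K ≠ 0) (h' : F' * sharp F = K' * sharp K) :
    F' * K = F * K' := by
  -- After multiplication by `K^♯`: `F' K K^♯ = F' F F^♯ = F K' K^♯`.
  refine hK.sharp.mul_left_cancel (fun h0 => hK0 (sharp_eq_zero_iff.1 h0)) (hF'.mul hK)
    (hF.mul hK') fun z => ?_
  have h1 := congrFun h z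
  have h2 := congrFun h' z
  simp only [Pi.mul_apply] at h1 h2 ⊢
  linear_combination F z * h2 - F' z * h1

/-- Near `w` the quotient `F / K` has zero derivative, so it is constant there; the identity theorem
extends the proportionality to the plane. -/
theorem mul_eq_mul_of_deriv_mul_eq_mul_deriv (hF : Differentiable ℂ F)
    (hK : Differentiable ℂ K) (h : deriv F * K = F * deriv K) {w : ℂ} (hw : K w ≠ 0) (z : ℂ) :
    K w * F z = F w * K z := by
  obtain ⟨r, hr, hball⟩ := Metric.eventually_nhds_iff_ball.1
    (hK.continuous.continuousAt.eventually_ne hw)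
  have hdiff : ∀ u ∈ Metric.ball w r, HasDerivAt (F / K) 0 u := fun u hu => by
    refine ((hF u).hasDerivAt.div (hK u).hasDerivAt (hball u hu)).congr_deriv ?_
    have := congrFun h u
    simp only [Pi.mul_apply] at this
    rw [this, sub_self, zero_div]
  have hconst : ∀ u ∈ Metric.ball w r, (F / K) u = (F / K) w := fun u hu =>
    Metric.isOpen_ball.is_const_of_deriv_eq_zero (convex_ball w r).isPreconnected
      (fun v hv => (hdiff v hv).differentiableAt.differentiableWithinAt)
      (fun v hv => (hdiff v hv).deriv) hu (Metric.mem_ball_self hr)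
  have heq : (fun z => K w * F z) = fun z => F w * K z := by
    refine AnalyticOnNhd.eq_of_eventuallyEq (z₀ := w)
      (Differentiable.analyticOnNhd_univ (by fun_prop))
      (Differentiable.analyticOnNhd_univ (by fun_prop)) ?_
    filter_upwards [Metric.ball_mem_nhds w hr] with u hu
    have := hconst u hu
    rw [Pi.div_apply, Pi.div_apply, div_eq_div_iff (hball u hu) hw] at this
    linear_combination this
  exact congrFun heq z

/-- Periodicity of `F / K` written without division. Each induction step cancels the factor `K (z +
n * b)`, which may have zeros but is not identically zero. -/
theorem mul_eq_mul_add_int_mul (hF : Differentiable ℂ F) (hK : Differentiable ℂ K) (hK0 : K ≠ 0)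
    {b : ℂ} (h : ∀ z, F (z + b) * K z = F z * K (z + b)) (k : ℤ) (z : ℂ) :
    F (z + k * b) * K z = F z * K (z + k * b) := by
  have key : ∀ (n : ℕ) (z : ℂ), F (z + n * b) * K z = F z * K (z + n * b) := by
    intro n
    induction n with
    | zero => simp
    | succ n ih =>
      refine fun z => congrFun (Differentiable.mul_left_cancel (K := fun z => K (z + n * b))
        (F := fun z => F (z + (n + 1 : ℕ) * b) * K z)
        (G := fun z => F z * K (z + (n + 1 : ℕ) * b)) (by fun_prop) (fun h0 => hK0 ?_)
        (by fun_prop) (by fun_prop) fun z => ?_) z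
      · ext z
        simpa using congrFun h0 (z - n * b)
      · have h1 := h (z + n * b)
        have h2 := ih z
        rw [show z + n * b + b = z + (n + 1 : ℕ) * b by push_cast; ring] at h1
        linear_combination K z * h1 + K (z + (n + 1 : ℕ) * b) * h2
  obtain ⟨n, rfl | rfl⟩ := k.eq_nat_or_neg
  · exact_mod_cast key n z
  · have := key n (z + ((-n : ℤ) : ℂ) * b)
    rw [show z + ((-n : ℤ) : ℂ) * b + n * b = z by push_cast; ring] at this
    linear_combination -this

end Entire

/-! ### Recovery up to a phase and `sharp` -/

namespace IsBandlimited

variable {R : ℝ} {F G K : ℂ → ℂ}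

/-- Bandlimited functions with `F F^♯ = K K^♯` and `F(z + b) F^♯(z) = K(z + b) K^♯(z)` agree up to
a phase if `b` is below the Nyquist spacing. -/
theorem exists_norm_one_eq_smul_of_shift {b : ℝ} (hF : IsBandlimited R F)
    (hK : IsBandlimited R K) (hb : 0 < b) (hR : 2 * R * b < 1)
    (h : F * _root_.sharp F = K * _root_.sharp K)
    (h' : (fun z => F (z + b)) * _root_.sharp F = (fun z => K (z + b)) * _root_.sharp K) :
    ∃ c : ℂ, ‖c‖ = 1 ∧ F = c • K := by
  by_cases hK0 : K = 0
  · exact exists_norm_one_eq_smul_of_eq_zero hF.differentiable h hK0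
  obtain ⟨w, hw⟩ := Function.ne_iff.1 hK0
  refine exists_norm_one_eq_smul_of_mul_sharp_eq hK.differentiable h
    ⟨w, hw, fun z => ?_⟩
  have h1 := mul_eq_mul_of_mul_sharp_eq hF.differentiable hK.differentiable
    (hF.comp_add_const b).differentiable (hK.comp_add_const b).differentiable h hK0 h'
  have h2 := mul_eq_mul_add_int_mul hF.differentiable hK.differentiable hK0
    (fun z => congrFun h1 z)
  have h3 := ((hF.const_smul (K w)).sub (hK.const_smul (F w))).eq_zero_of_forall_lattice_eq_zero
    hb hR w fun k => by
      simp only [Pi.sub_apply, Pi.smul_apply, smul_eq_mul]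
      linear_combination h2 k w
  exact sub_eq_zero.1 (congrFun h3 z)

theorem eq_smul_or_eq_smul_sharp_of_shift {b : ℝ} (hF : IsBandlimited R F)
    (hG : IsBandlimited R G) (hb : 0 < b) (hR : 2 * R * b < 1)
    (h : F * _root_.sharp F = G * _root_.sharp G)
    (h' : (fun z => F (z + b) - F z) * _root_.sharp (fun z => F (z + b) - F z) =
      (fun z => G (z + b) - G z) * _root_.sharp (fun z => G (z + b) - G z)) :
    ∃ c : ℂ, ‖c‖ = 1 ∧ (F = c • G ∨ F = c • _root_.sharp G) := by
  have hshift : ∀ (H : ℂ → ℂ) (z : ℂ), _root_.sharp (fun z => H (z + b) - H z) z =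
      _root_.sharp H (z + b) - _root_.sharp H z := fun H z => by
    simp [_root_.sharp]
  have hu : ∀ z, F z * _root_.sharp F z = G z * _root_.sharp G z := congrFun h
  have hv : ∀ z, (F (z + b) - F z) * (_root_.sharp F (z + b) - _root_.sharp F z) =
      (G (z + b) - G z) * (_root_.sharp G (z + b) - _root_.sharp G z) := fun z => by
    simpa only [Pi.mul_apply, hshift] using congrFun h' z
  have dF := hF.differentiable
  have dG := hG.differentiable
  have dF' := hF.sharp.differentiable
  have dG' := hG.sharp.differentiable
  rcases Differentiable.eq_or_eq_of_add_eq_of_mul_eq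
    (P := fun z => F (z + b) * _root_.sharp F z) (P' := fun z => F z * _root_.sharp F (z + b))
    (Q := fun z => G (z + b) * _root_.sharp G z) (Q' := fun z => G z * _root_.sharp G (z + b))
    (by fun_prop) (by fun_prop) (by fun_prop)
    -- Expanding the difference product leaves the two diagonal terms minus the sum of the cross
    -- terms.
    (fun z => by linear_combination hu z + hu (z + b) - hv z)
    (fun z => by
      linear_combination F z * _root_.sharp F z * hu (z + b) +
        G (z + b) * _root_.sharp G (z + b) * hu z) with hP | hP
  · obtain ⟨c, hc, hFc⟩ := hF.exists_norm_one_eq_smul_of_shift hG hb hR h hP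
    exact ⟨c, hc, Or.inl hFc⟩
  -- The cross terms of `G^♯` are those of `G` in the opposite order.
  · obtain ⟨c, hc, hFc⟩ := hF.exists_norm_one_eq_smul_of_shift hG.sharp hb hR
      (by rw [sharp_sharp, h, mul_comm])
      (by rw [sharp_sharp]; refine Eq.trans hP ?_; ext z; exact mul_comm _ _)
    exact ⟨c, hc, Or.inr hFc⟩

end IsBandlimited

theorem exists_norm_one_eq_smul_of_deriv {F K : ℂ → ℂ} (hF : Differentiable ℂ F)
    (hK : Differentiable ℂ K) (h : F * sharp F = K * sharp K)
    (h' : deriv F * sharp F = deriv K * sharp K) : ∃ c : ℂ, ‖c‖ = 1 ∧ F = c • K := by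
  by_cases hK0 : K = 0
  · exact exists_norm_one_eq_smul_of_eq_zero hF h hK0
  obtain ⟨w, hw⟩ := Function.ne_iff.1 hK0
  exact exists_norm_one_eq_smul_of_mul_sharp_eq hK h ⟨w, hw,
    mul_eq_mul_of_deriv_mul_eq_mul_deriv hF hK
      (mul_eq_mul_of_mul_sharp_eq hF hK hF.deriv hK.deriv h hK0 h') hw⟩

theorem eq_smul_or_eq_smul_sharp_of_deriv {F G : ℂ → ℂ} (hF : Differentiable ℂ F)
    (hG : Differentiable ℂ G) (h : F * sharp F = G * sharp G)
    (h' : deriv F * sharp (deriv F) = deriv G * sharp (deriv G)) :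
    ∃ c : ℂ, ‖c‖ = 1 ∧ (F = c • G ∨ F = c • sharp G) := by
  have hu : ∀ z, F z * sharp F z = G z * sharp G z := congrFun h
  have hv : ∀ z, deriv F z * sharp (deriv F) z = deriv G z * sharp (deriv G) z := congrFun h'
  have hd : ∀ H : ℂ → ℂ, Differentiable ℂ H → ∀ z,
      deriv (H * sharp H) z = deriv H z * sharp H z + H z * sharp (deriv H) z := fun H hH z => by
    rw [deriv_mul (hH z) (hH.sharp z), deriv_sharp]
  rcases (hF.deriv.mul hF.sharp).eq_or_eq_of_add_eq_of_mul_eq (P' := F * sharp (deriv F))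
    (hG.deriv.mul hG.sharp) (hG.mul hG.deriv.sharp)
    (fun z => by
      simp only [Pi.mul_apply]
      -- The sum of the two terms is the derivative of `F F^♯`.
      rw [← hd F hF, ← hd G hG, h])
    (fun z => by
      simp only [Pi.mul_apply]
      linear_combination deriv F z * sharp (deriv F) z * hu z +
        G z * sharp G z * hv z) with hP | hP
  · obtain ⟨c, hc, hFc⟩ := exists_norm_one_eq_smul_of_deriv hF hG h hP
    exact ⟨c, hc, Or.inl hFc⟩
  · obtain ⟨c, hc, hFc⟩ := exists_norm_one_eq_smul_of_deriv hF hG.sharp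
      (by rw [sharp_sharp, h, mul_comm]) (by rw [sharp_sharp, hP, deriv_sharp, mul_comm])
    exact ⟨c, hc, Or.inr hFc⟩

theorem pwExt_zero (γ : ℝ) : pwExt (0 : PW γ) = 0 := by
  ext z
  simp [pwExt]

theorem sharp_ofReal (F : ℂ → ℂ) (x : ℝ) : sharp F x = conj (F x) := by
  rw [sharp, Complex.conj_ofReal]

/-! ### From samples to identities of entire functions -/

section Sampling

variable {γ : ℝ} {t : ℤ → ℝ} {F G : ℂ → ℂ}

theorem IsSetOfSampling.summable_norm_sq (ht : IsSetOfSampling γ t)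
    (hF : IsBandlimited (γ / (2 * Real.pi)) F) : Summable fun n => ‖F (t n)‖ ^ 2 := by
  obtain ⟨A, B, -, -, h⟩ := ht
  obtain ⟨f, rfl⟩ := hF.exists_pwExt_eq
  exact (h f).1

theorem IsSetOfSampling.eq_zero (ht : IsSetOfSampling γ t)
    (hF : IsBandlimited (γ / (2 * Real.pi)) F) (h0 : ∀ n, F (t n) = 0) : F = 0 := by
  obtain ⟨A, B, hA, -, h⟩ := ht
  obtain ⟨f, rfl⟩ := hF.exists_pwExt_eq
  have h1 := (h f).2.1
  simp only [h0, norm_zero, ne_eq, OfNat.ofNat_ne_zero, not_false_eq_true, zero_pow,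
    tsum_zero] at h1
  have hf : f = 0 := by
    by_contra hne
    have : 0 < A * ‖f‖ ^ 2 := by
      have := norm_pos_iff.2 hne
      positivity
    linarith
  rw [hf, pwExt_zero]

theorem IsSetOfSampling.mul_sharp_eq (ht : IsSetOfSampling (2 * γ) t)
    (hF : IsBandlimited (γ / (2 * Real.pi)) F) (hG : IsBandlimited (γ / (2 * Real.pi)) G)
    (h : ∀ n, ‖F (t n)‖ = ‖G (t n)‖) : F * sharp F = G * sharp G := by
  have hH := (hF.mul hF.sharp).sub (hG.mul hG.sharp)
  rw [show γ / (2 * Real.pi) + γ / (2 * Real.pi) = 2 * γ / (2 * Real.pi) by ring] at hH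
  refine sub_eq_zero.1 (ht.eq_zero hH fun n => ?_)
  simp only [Pi.sub_apply, Pi.mul_apply, sharp_ofReal, Complex.mul_conj', h, sub_self]

theorem IsSetOfSampling.memℓp_norm (hγ : 0 ≤ γ) (ht : IsSetOfSampling (2 * γ) t)
    (hF : IsBandlimited (γ / (2 * Real.pi)) F) : Memℓp (fun n => ‖F (t n)‖) 2 := by
  rw [memℓp_gen_iff (by norm_num)]
  -- Sampling is assumed for the doubled band, which contains the original one.
  have hle : γ / (2 * Real.pi) ≤ 2 * γ / (2 * Real.pi) := by
    gcongr
    linarith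
  simpa using ht.summable_norm_sq (hF.mono hle)

/-- Phaseless measurements of `f` and of `D f` at sampling points define a map on `PW_γ / ∼`, which
is injective if `f` is determined up to `∼` by `f f^♯` and `D f (D f)^♯`. -/
theorem IsSetOfSampling.exists_injective_measurement (hγ : 0 ≤ γ)
    (ht : IsSetOfSampling (2 * γ) t) (D : (ℂ → ℂ) → ℂ → ℂ)
    (hD : ∀ F, IsBandlimited (γ / (2 * Real.pi)) F → IsBandlimited (γ / (2 * Real.pi)) (D F))
    (hsmul : ∀ (c : ℂ) F, D (c • F) = c • D F) (hsharp : ∀ F, D (sharp F) = sharp (D F))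
    (hinj : ∀ F G, IsBandlimited (γ / (2 * Real.pi)) F → IsBandlimited (γ / (2 * Real.pi)) G →
      F * sharp F = G * sharp G → D F * sharp (D F) = D G * sharp (D G) →
      ∃ c : ℂ, ‖c‖ = 1 ∧ (F = c • G ∨ F = c • sharp G)) :
    ∃ A : Quotient (pwSetoid γ) → EllTwo × EllTwo,
      (∀ (f : PW γ) (n : ℤ),
        (A (Quotient.mk (pwSetoid γ) f)).1 n = ‖pwExt f (t n)‖ ∧
        (A (Quotient.mk (pwSetoid γ) f)).2 n = ‖D (pwExt f) (t n)‖) ∧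
      Function.Injective A := by
  let a : PW γ → EllTwo × EllTwo := fun f =>
    (⟨_, ht.memℓp_norm hγ (isBandlimited_pwExt f)⟩,
      ⟨_, ht.memℓp_norm hγ (hD _ (isBandlimited_pwExt f))⟩)
  have ha : ∀ f g : PW γ, (pwSetoid γ).r f g → a f = a g := by
    rintro f g ⟨c, hc, h | h⟩ <;>
    refine Prod.ext (Subtype.ext (funext fun n => ?_)) (Subtype.ext (funext fun n => ?_)) <;>
    simp [a, h, hsmul, hsharp, hc, sharp_ofReal]
  refine ⟨Quotient.lift a ha, fun f n => ⟨rfl, rfl⟩, ?_⟩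
  rintro ⟨f⟩ ⟨g⟩ h
  have h1 : a f = a g := h
  have hf := isBandlimited_pwExt f
  have hg := isBandlimited_pwExt g
  exact Quotient.sound (hinj _ _ hf hg
    (ht.mul_sharp_eq hf hg fun n => congrArg (fun p : EllTwo × EllTwo => p.1 n) h1)
    (ht.mul_sharp_eq (hD _ hf) (hD _ hg) fun n => congrArg (fun p : EllTwo × EllTwo => p.2 n) h1))

end Sampling

theorem mainTheorem3 (γ : ℝ) (hγ : 0 < γ) (t : ℤ → ℝ) (ht : IsSetOfSampling (2 * γ) t) :
    (∀ b : ℝ, 0 < b → b < Real.pi / γ →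
      ∃ A : Quotient (pwSetoid γ) → EllTwo × EllTwo,
        (∀ (f : PW γ) (n : ℤ),
          (A (Quotient.mk (pwSetoid γ) f)).1 n = ‖pwExt f (t n)‖ ∧
          (A (Quotient.mk (pwSetoid γ) f)).2 n = ‖pwExt f (t n + b) - pwExt f (t n)‖) ∧
        Function.Injective A) ∧
    (∃ A : Quotient (pwSetoid γ) → EllTwo × EllTwo,
      (∀ (f : PW γ) (n : ℤ),
        (A (Quotient.mk (pwSetoid γ) f)).1 n = ‖pwExt f (t n)‖ ∧
        (A (Quotient.mk (pwSetoid γ) f)).2 n = ‖deriv (pwExt f) (t n)‖) ∧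
      Function.Injective A) := by
  refine ⟨fun b hb hbγ => ?_, ?_⟩
  -- The condition `b < π / γ` in the frequency normalization of `IsBandlimited`.
  · have hR : 2 * (γ / (2 * Real.pi)) * b < 1 := by
      rw [lt_div_iff₀ hγ] at hbγ
      rw [show 2 * (γ / (2 * Real.pi)) * b = b * γ / Real.pi by field_simp,
        div_lt_one Real.pi_pos]
      exact hbγ
    refine ht.exists_injective_measurement hγ.le (fun F z => F (z + b) - F z)
      (fun F hF => (hF.comp_add_const b).sub hF) (fun c F => ?_) (fun F => ?_)
      fun F G hF hG => hF.eq_smul_or_eq_smul_sharp_of_shift hG hb hR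
    · ext z
      simp [mul_sub]
    · ext z
      simp [sharp]
  · refine ht.exists_injective_measurement hγ.le deriv (fun F hF => hF.deriv) (fun c F => ?_)
      deriv_sharp
      fun F G hF hG => eq_smul_or_eq_smul_sharp_of_deriv hF.differentiable hG.differentiable
    ext z
    exact deriv_const_smul_field c F
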